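/- Let $\mathscr{C}$ be a skeletally small Krull–Schmidt additive category with an extriangulated structure $(\mathbb{E},\mathfrak{s})$ in the sense of Nakaoka and Palu. For a class $\mathcal{X}$ of objects of $\mathscr{C}$, closed under isomorphisms, an $\mathcal{X}$-filtration of length $n\ge 0$ of an object $M$ is a sequence $$0=M_0\xrightarrow{f_0}M_1\xrightarrow{f_1}\cdots\xrightarrow{f_{n-1}}M_n=M$$ of inflations with $\operatorname{cone}(f_i)\in\mathcal{X}$ for $0\le i\le n-1$; one writes $M\sim(\operatorname{cone}(f_0),\dots,\operatorname{cone}(f_{n-1}))_{\mathcal{X}}$. Let $\mathbf{Filt}_{\mathscr{C}}(\mathcal{X})$ be the full subcategory of all objects that have an $\mathcal{X}$-filtration, and for such an object $M$ let $l_{\mathcal{X}}(M)$ be the minimal length of its $\mathcal{X}$-filtrations. Let $\mathcal{X}$ be a semibrick in $\mathscr{C}$: a set of isomorphism classes of objects whose endomorphism rings are division rings, such that $\operatorname{Hom}_{\mathscr{C}}(X,Y)=0$ for any two non-isomorphic $X,Y\in\mathcal{X}$. Put $\mathcal{T}=\mathbf{Filt}_{\mathscr{C}}(\mathcal{X})$.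 Then $\mathcal{X}\subseteq\mathcal{T}$, the subcategory $\mathcal{T}$ is closed under extensions in $\mathscr{C}$, and with the structure inherited from $\mathscr{C}$ (restrict $\mathbb{E}$; the conflations in $\mathcal{T}$ are the conflations of $\mathscr{C}$ with all three terms in $\mathcal{T}$) $\mathcal{T}$ satisfies the weak Jordan–Hölder property with respect to $\mathcal{X}$, that is: 1. $\mathcal{T}=\mathbf{Filt}_{\mathcal{T}}(\mathcal{X})$; 2. for each $M\in\mathcal{T}$ with $l_{\mathcal{X}}(M)=n$ (computed in $\mathcal{T}$), if $M\sim(X_1,\dots,X_n)_{\mathcal{X}}$ and $M\sim(Y_1,\dots,Y_n)_{\mathcal{X}}$ in $\mathcal{T}$, then there is a permutation $\sigma$ of $\{1,\dots,n\}$ with $X_i\cong Y_{\sigma(i)}$ for all $i$. -/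

import Mathlib

open CategoryTheory CategoryTheory.Limits

universe w v u

attribute [local instance] hasBinaryBiproducts_of_finite_biproducts

namespace Extri

/-- The data underlying an extriangulated category: a bifunctor `𝔼 : Cᵒᵖ × C → Ab`
(in curried form) and a correspondence between elements of `𝔼(Z, A)` and sequences
`A ⟶ B ⟶ Z`. `Realizes δ x y` means that the sequence `(x, y)` belongs to the class `𝔰(δ)`.
The axioms are in `ExtData.IsExtriangulated`. -/
structure ExtData (C : Type u) [Category.{v} C] where
  /-- The bifunctor of extensions. -/
  E : Cᵒᵖ ⥤ C ⥤ AddCommGrpCat.{w}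
  /-- The sequence `A ⟶ B ⟶ Z` belongs to the class `𝔰(δ)`. -/
  Realizes : ∀ {A B Z : C}, ((E.obj (Opposite.op Z)).obj A) → (A ⟶ B) → (B ⟶ Z) → Prop

namespace ExtData

section Data

variable {C : Type u} [Category.{v} C] (D : ExtData.{w} C)

/-- The group `𝔼(Z, A)` of extensions. -/
abbrev Ext (Z A : C) : Type w := (D.E.obj (Opposite.op Z)).obj A

variable {D}

/-- `a_* δ = 𝔼(Z, a)(δ)`. -/
def push {Z A A' : C} (a : A ⟶ A') (δ : D.Ext Z A) : D.Ext Z A' :=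
  (D.E.obj (Opposite.op Z)).map a δ

/-- `c^* δ = 𝔼(c, A)(δ)`. -/
def pull {Z Z' A : C} (c : Z' ⟶ Z) (δ : D.Ext Z A) : D.Ext Z' A :=
  (D.E.map c.op).app A δ

variable (D)

/-- Conflations: the sequences `A ⟶ B ⟶ Z` which realize some extension. Then `x` is an
inflation, `y` is a deflation and `Z = cone x`. -/
def Conflation {A B Z : C} (x : A ⟶ B) (y : B ⟶ Z) : Prop :=
  ∃ δ : D.Ext Z A, D.Realizes δ x y

/-- The data inherited by a full subcategory `T`: the bifunctor is the restriction of `𝔼`, and a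
sequence in `T` realizes `δ` exactly if it does so in `C`. -/
def restrict (T : ObjectProperty C) : ExtData.{w} T.FullSubcategory where
  E := T.ι.op ⋙ D.E ⋙ (Functor.whiskeringLeft _ _ _).obj T.ι
  Realizes {A _ Z} δ x y :=
    D.Realizes (show D.Ext (T.ι.obj Z) (T.ι.obj A) from δ) (T.ι.map x) (T.ι.map y)

/-- `D.HasFiltration 𝒳 M [X₁, …, Xₙ]` says that there is an `𝒳`-filtration
`0 = M₀ ⟶ M₁ ⟶ ⋯ ⟶ Mₙ = M` by inflations, with `cone (M_{i-1} ⟶ M_i) = X_i` in `𝒳` for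
`i = 1, …, n`, i.e. that `M ∼ (X₁, …, Xₙ)_𝒳`. -/
inductive HasFiltration (𝒳 : ObjectProperty C) : C → List C → Prop
  | zero {M : C} (hM : IsZero M) : HasFiltration 𝒳 M []
  | step {M N X : C} {l : List C} (f : M ⟶ N) (g : N ⟶ X) (h : D.Conflation f g) (hX : 𝒳 X)
      (hM : HasFiltration 𝒳 M l) : HasFiltration 𝒳 N (l ++ [X])

/-- The filtration subcategory `Filt_C(𝒳)`. -/
def Filt (𝒳 : ObjectProperty C) : ObjectProperty C :=
  fun M => ∃ l : List C, D.HasFiltration 𝒳 M l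

/-- The `𝒳`-length of `M`: the minimal length of an `𝒳`-filtration of `M`
(used only for objects which have an `𝒳`-filtration). -/
noncomputable def length (𝒳 : ObjectProperty C) (M : C) : ℕ :=
  sInf {n : ℕ | ∃ l : List C, D.HasFiltration 𝒳 M l ∧ l.length = n}

/-- The subcategory `T` is closed under extensions. -/
def IsExtensionClosed (T : ObjectProperty C) : Prop :=
  ∀ ⦃A B Z : C⦄ (x : A ⟶ B) (y : B ⟶ Z), D.Conflation x y → T A → T Z → T B

end Data

/-- Two sequences of objects are isomorphic: they have the same length, and some permutation
matches their terms up to isomorphism. -/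
def SeqIso {C : Type u} [Category.{v} C] (l l' : List C) : Prop :=
  ∃ σ : Fin l.length ≃ Fin l'.length, ∀ i, Nonempty (l.get i ≅ l'.get (σ i))

/-- The weak Jordan–Hölder property of `C` with respect to the set `𝒳` of objects of `C`:
`C = Filt_C(𝒳)`, and all `𝒳`-filtrations of minimal length of an object have isomorphic sequences
of factors. -/
structure WeakJordanHolder {C : Type u} [Category.{v} C] (D : ExtData.{w} C)
    (𝒳 : ObjectProperty C) : Prop where
  filt : ∀ M : C, D.Filt 𝒳 M
  unique : ∀ (M : C) (l l' : List C), D.HasFiltration 𝒳 M l → D.HasFiltration 𝒳 M l' →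
    l.length = D.length 𝒳 M → l'.length = D.length 𝒳 M → SeqIso l l'

section Axioms

variable {C : Type u} [Category.{v} C] [Preadditive C] [HasFiniteBiproducts C]

/-- The extension `δ ⊕ δ'` in `𝔼(Z ⊕ Z', A ⊕ A')`, which corresponds to `(δ, 0, 0, δ')`. -/
noncomputable def sum {D : ExtData.{w} C} {Z Z' A A' : C} (δ : D.Ext Z A) (δ' : D.Ext Z' A') :
    D.Ext (Z ⊞ Z') (A ⊞ A') :=
  push (biprod.inl : A ⟶ A ⊞ A') (pull (biprod.fst : Z ⊞ Z' ⟶ Z) δ) +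
    push (biprod.inr : A' ⟶ A ⊞ A') (pull (biprod.snd : Z ⊞ Z' ⟶ Z') δ')

/-- The axioms of an extriangulated category, in the sense of Nakaoka and Palu. -/
structure IsExtriangulated (D : ExtData.{w} C) : Prop where
  /-- (ET1): `𝔼` is additive in each variable. -/
  additive_right : ∀ Z : Cᵒᵖ, (D.E.obj Z).Additive
  additive_left : ∀ A : C, (D.E.flip.obj A).Additive
  /-- (ET2), first part: `𝔰(δ)` is an equivalence class of sequences, where `A ⟶ B ⟶ Z` and
  `A ⟶ B' ⟶ Z` are equivalent if there is a compatible isomorphism `B ≅ B'`. -/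
  exists_realizes : ∀ {A Z : C} (δ : D.Ext Z A),
    ∃ (B : C) (x : A ⟶ B) (y : B ⟶ Z), D.Realizes δ x y
  realizes_of_iso : ∀ {A B B' Z : C} (δ : D.Ext Z A) (x : A ⟶ B) (y : B ⟶ Z) (b : B ≅ B'),
    D.Realizes δ x y → D.Realizes δ (x ≫ b.hom) (b.inv ≫ y)
  iso_of_realizes : ∀ {A B B' Z : C} (δ : D.Ext Z A) (x : A ⟶ B) (y : B ⟶ Z) (x' : A ⟶ B')
    (y' : B' ⟶ Z), D.Realizes δ x y → D.Realizes δ x' y' →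
    ∃ b : B ≅ B', x ≫ b.hom = x' ∧ b.hom ≫ y' = y
  /-- (ET2), second part: morphisms of extensions are realized. -/
  realizes_hom : ∀ {A B Z A' B' Z' : C} (δ : D.Ext Z A) (δ' : D.Ext Z' A') (x : A ⟶ B)
    (y : B ⟶ Z) (x' : A' ⟶ B') (y' : B' ⟶ Z') (a : A ⟶ A') (c : Z ⟶ Z'),
    D.Realizes δ x y → D.Realizes δ' x' y' → push a δ = pull c δ' →
    ∃ b : B ⟶ B', x ≫ b = a ≫ x' ∧ b ≫ y' = y ≫ c
  /-- (ET2), third part: `𝔰` is additive. -/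
  realizes_zero : ∀ A Z : C,
    D.Realizes (0 : D.Ext Z A) (biprod.inl : A ⟶ A ⊞ Z) (biprod.snd : A ⊞ Z ⟶ Z)
  realizes_sum : ∀ {A B Z A' B' Z' : C} (δ : D.Ext Z A) (δ' : D.Ext Z' A') (x : A ⟶ B)
    (y : B ⟶ Z) (x' : A' ⟶ B') (y' : B' ⟶ Z'), D.Realizes δ x y → D.Realizes δ' x' y' →
    D.Realizes (sum δ δ') (biprod.map x x') (biprod.map y y')
  /-- (ET3) -/
  et3 : ∀ {A B Z A' B' Z' : C} (δ : D.Ext Z A) (δ' : D.Ext Z' A') (x : A ⟶ B) (y : B ⟶ Z)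
    (x' : A' ⟶ B') (y' : B' ⟶ Z') (a : A ⟶ A') (b : B ⟶ B'),
    D.Realizes δ x y → D.Realizes δ' x' y' → x ≫ b = a ≫ x' →
    ∃ c : Z ⟶ Z', b ≫ y' = y ≫ c ∧ push a δ = pull c δ'
  /-- (ET3)ᵒᵖ -/
  et3_op : ∀ {A B Z A' B' Z' : C} (δ : D.Ext Z A) (δ' : D.Ext Z' A') (x : A ⟶ B) (y : B ⟶ Z)
    (x' : A' ⟶ B') (y' : B' ⟶ Z') (b : B ⟶ B') (c : Z ⟶ Z'),
    D.Realizes δ x y → D.Realizes δ' x' y' → b ≫ y' = y ≫ c →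
    ∃ a : A ⟶ A', x ≫ b = a ≫ x' ∧ push a δ = pull c δ'
  /-- (ET4) for `A ⟶ B ⟶ K` and `B ⟶ M ⟶ F`. -/
  et4 : ∀ {A B K M F : C} (δ : D.Ext K A) (δ' : D.Ext F B) (f : A ⟶ B) (f' : B ⟶ K)
    (g : B ⟶ M) (g' : M ⟶ F), D.Realizes δ f f' → D.Realizes δ' g g' →
    ∃ (N : C) (h' : M ⟶ N) (d : K ⟶ N) (e : N ⟶ F) (δ'' : D.Ext N A),
      D.Realizes δ'' (f ≫ g) h' ∧ f' ≫ d = g ≫ h' ∧ h' ≫ e = g' ∧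
      D.Realizes (push f' δ') d e ∧ pull d δ'' = δ ∧ push f δ'' = pull e δ'
  /-- (ET4)ᵒᵖ for `K ⟶ A ⟶ B` and `F ⟶ B ⟶ M`. -/
  et4_op : ∀ {A B K M F : C} (δ : D.Ext B K) (δ' : D.Ext M F) (f' : K ⟶ A) (f : A ⟶ B)
    (g' : F ⟶ B) (g : B ⟶ M), D.Realizes δ f' f → D.Realizes δ' g' g →
    ∃ (N : C) (h' : N ⟶ A) (d : K ⟶ N) (e : N ⟶ F) (δ'' : D.Ext M N),
      D.Realizes δ'' h' (f ≫ g) ∧ d ≫ h' = f' ∧ h' ≫ f = e ≫ g' ∧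
      D.Realizes (pull g' δ) d e ∧ push e δ'' = δ' ∧ push d δ = pull g δ''

end Axioms

end ExtData

/-- An additive category is Krull–Schmidt if every object is a finite direct sum of objects with
local endomorphism rings. -/
def IsKrullSchmidt (C : Type u) [Category.{v} C] [Preadditive C] [HasFiniteBiproducts C] : Prop :=
  ∀ M : C, ∃ (n : ℕ) (X : Fin n → C),
    (∀ i, IsLocalRing (End (X i))) ∧ Nonempty (M ≅ ⨁ X)

/-- A brick: an object whose endomorphism ring is a division ring. -/
def IsBrick {C : Type u} [Category.{v} C] [Preadditive C] (X : C) : Prop :=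
  Nontrivial (End X) ∧ ∀ f : End X, f ≠ 0 → IsUnit f

/-- A semibrick. A set of isomorphism classes of objects is the same as a property of objects
which is closed under isomorphisms. -/
structure IsSemibrick {C : Type u} [Category.{v} C] [Preadditive C] (𝒳 : ObjectProperty C) :
    Prop where
  closedUnderIso : 𝒳.IsClosedUnderIsomorphisms
  brick : ∀ X, 𝒳 X → IsBrick X
  hom_eq_zero : ∀ X Y, 𝒳 X → 𝒳 Y → ¬ Nonempty (X ≅ Y) → ∀ f : X ⟶ Y, f = 0

end Extri

/- A nonzero morphism from a filtered object to a member of the semibrick is a deflation, and its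
fibre inherits the filtration with one factor removed. Hence the `𝒳`-length does not increase under
retracts. So the last deflation `M ⟶ S` of a minimal filtration is nonzero, as otherwise `M` would
be a retract of the preceding term, which has smaller length. Any other minimal filtration of `M`
can therefore be exchanged for one ending with the factor `S` and the same preceding term, and
induction applies to that term. -/

namespace Extri

section Preliminaries

variable {C : Type u} [Category.{v} C]

theorem isIso_of_isIso_comp_comp {X Y : C} (f : X ⟶ Y) (g : Y ⟶ X) [IsIso (f ≫ g)]
    [IsIso (g ≫ f)] : IsIso f := by
  have : IsSplitMono f := .mk' ⟨g ≫ inv (f ≫ g), by rw [← Category.assoc, IsIso.hom_inv_id]⟩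
  have : Epi f := epi_of_epi g f
  exact isIso_of_epi_of_isSplitMono f

theorem isIso_of_sub_id_comp_self_eq_zero [Preadditive C] {X : C} (f : X ⟶ X)
    (h : (f - 𝟙 X) ≫ (f - 𝟙 X) = 0) : IsIso f := by
  have hnil : IsNilpotent (show End X from f - 𝟙 X) := ⟨2, by rw [pow_two]; exact h⟩
  have hunit := hnil.isUnit_add_one
  rwa [show (show End X from f - 𝟙 X) + 1 = f from sub_add_cancel f (𝟙 X),
    isUnit_iff_isIso] at hunit

/-- The multiset of isomorphism classes of the terms of a sequence of objects; sequences are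
isomorphic in the sense of `ExtData.SeqIso` when these multisets agree. -/
def isoClasses (l : List C) : Multiset (Quotient (isIsomorphicSetoid C)) :=
  Multiset.map (Quotient.mk _) l

theorem isoClasses_append (l l' : List C) :
    isoClasses (l ++ l') = isoClasses l + isoClasses l' := by
  simp only [isoClasses, ← Multiset.coe_add, Multiset.map_add]

theorem isoClasses_singleton_eq {X Y : C} (e : X ≅ Y) : isoClasses [X] = isoClasses [Y] :=
  congrArg (fun c => ({c} : Multiset _)) (Quotient.sound ⟨e⟩)

theorem length_eq_of_isoClasses_eq {l l' : List C} (h : isoClasses l = isoClasses l') :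
    l.length = l'.length := by
  simpa only [isoClasses, Multiset.card_map, Multiset.coe_card] using congrArg Multiset.card h

open Classical in
theorem exists_equiv_get_eq_of_perm {α : Type*} {l l' : List α} (h : l.Perm l') :
    ∃ σ : Fin l.length ≃ Fin l'.length, ∀ i, l'.get (σ i) = l.get i :=
  ⟨{ toFun := h.idxBij
     invFun := h.symm.idxBij
     left_inv := h.idxBij_rightInverse_idxBij_symm
     right_inv := h.idxBij_leftInverse_idxBij_symm }, h.getElem_idxBij_eq_getElem⟩

theorem ExtData.SeqIso.of_isoClasses_eq {l l' : List C} (h : isoClasses l = isoClasses l') :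
    ExtData.SeqIso l l' := by
  obtain ⟨σ, hσ⟩ := exists_equiv_get_eq_of_perm (Multiset.coe_eq_coe.1 h)
  refine ⟨(finCongr (List.length_map _).symm).trans (σ.trans (finCongr (List.length_map _))),
    fun i => ?_⟩
  have hi := hσ (Fin.cast (List.length_map _).symm i)
  simp only [List.get_eq_getElem, List.getElem_map] at hi
  exact Quotient.exact hi.symm

theorem ExtData.SeqIso.of_map_obj {C' : Type*} [Category* C'] (F : C ⥤ C') [F.Full] [F.Faithful]
    {l l' : List C} (h : ExtData.SeqIso (l.map F.obj) (l'.map F.obj)) :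
    ExtData.SeqIso l l' := by
  obtain ⟨σ, hσ⟩ := h
  refine ⟨(finCongr (List.length_map _).symm).trans (σ.trans (finCongr (List.length_map _))),
    fun i => ?_⟩
  obtain ⟨e⟩ := hσ (Fin.cast (List.length_map _).symm i)
  simp only [List.get_eq_getElem, List.getElem_map] at e
  exact ⟨F.preimageIso e⟩

theorem IsSemibrick.isIso_of_ne_zero [Preadditive C] {𝒳 : ObjectProperty C} (h𝒳 : IsSemibrick 𝒳)
    {X Y : C} (hX : 𝒳 X) (hY : 𝒳 Y) {f : X ⟶ Y} (hf : f ≠ 0) : IsIso f := by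
  obtain ⟨e⟩ : Nonempty (X ≅ Y) := by
    by_contra h
    exact hf (h𝒳.hom_eq_zero X Y hX hY h f)
  have hne : f ≫ e.inv ≠ 0 := fun h => hf ((Preadditive.IsIso.comp_right_eq_zero f e.inv).1 h)
  have : IsIso (f ≫ e.inv) := (isUnit_iff_isIso _).1 ((h𝒳.brick X hX).2 _ hne)
  exact IsIso.of_isIso_comp_right f e.inv

end Preliminaries

namespace ExtData

section Functoriality

variable {C : Type u} [Category.{v} C] {D : ExtData.{w} C}

theorem push_id {Z A : C} (δ : D.Ext Z A) : push (𝟙 A) δ = δ := by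
  simp [push]

theorem push_comp {Z A A' A'' : C} (a : A ⟶ A') (b : A' ⟶ A'') (δ : D.Ext Z A) :
    push (a ≫ b) δ = push b (push a δ) := by
  simp [push]

theorem pull_zero {Z Z' A : C} (c : Z' ⟶ Z) : pull c (0 : D.Ext Z A) = 0 :=
  map_zero ((D.E.map c.op).app A).hom

theorem pull_id {Z A : C} (δ : D.Ext Z A) : pull (𝟙 Z) δ = δ := by
  simp [pull]

theorem pull_comp {Z Z' Z'' A : C} (c : Z' ⟶ Z) (d : Z'' ⟶ Z') (δ : D.Ext Z A) :
    pull (d ≫ c) δ = pull d (pull c δ) := by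
  simp [pull]

theorem push_pull {Z Z' A A' : C} (a : A ⟶ A') (c : Z' ⟶ Z) (δ : D.Ext Z A) :
    push a (pull c δ) = pull c (push a δ) :=
  (ConcreteCategory.congr_hom ((D.E.map c.op).naturality a) δ).symm

end Functoriality

namespace IsExtriangulated

variable {C : Type u} [Category.{v} C] [Preadditive C] [HasFiniteBiproducts C] {D : ExtData.{w} C}

theorem push_sub (hD : D.IsExtriangulated) {Z A A' : C} (a b : A ⟶ A') (δ : D.Ext Z A) :
    push (a - b) δ = push a δ - push b δ := by
  have := hD.additive_right (Opposite.op Z)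
  simp [push, Functor.map_sub]

theorem ext_eq_zero_of_isZero (hD : D.IsExtriangulated) {Z A : C} (hZ : IsZero Z)
    (δ : D.Ext Z A) : δ = 0 := by
  have := hD.additive_left A
  have h : (D.E.flip.obj A).map (0 : Z ⟶ Z).op = 0 := by rw [op_zero, Functor.map_zero]
  rw [← pull_id δ, hZ.eq_of_src (𝟙 Z) 0]
  exact congrArg (fun φ => φ δ) h

section Conflations

variable {A B Z : C} {x : A ⟶ B} {y : B ⟶ Z}

theorem comp_eq_zero (hD : D.IsExtriangulated) (h : D.Conflation x y) : x ≫ y = 0 := by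
  obtain ⟨δ, h⟩ := h
  obtain ⟨c, hc, -⟩ := hD.et3 _ _ _ _ _ _ (𝟙 A) (biprod.fst ≫ x) (hD.realizes_zero A A) h
    (by simp)
  have := congrArg (biprod.inl ≫ ·) hc
  simpa using this

theorem exists_desc (hD : D.IsExtriangulated) {W : C} (h : D.Conflation x y) (f : B ⟶ W)
    (hf : x ≫ f = 0) : ∃ c : Z ⟶ W, y ≫ c = f := by
  obtain ⟨δ, h⟩ := h
  obtain ⟨c, hc, -⟩ := hD.et3 _ _ _ _ _ _ 0 (f ≫ biprod.inr) h (hD.realizes_zero A W)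
    (by rw [reassoc_of% hf, zero_comp, zero_comp])
  exact ⟨c, by simpa using hc.symm⟩

theorem exists_lift (hD : D.IsExtriangulated) {W : C} (h : D.Conflation x y) (f : W ⟶ B)
    (hf : f ≫ y = 0) : ∃ a : W ⟶ A, a ≫ x = f := by
  obtain ⟨δ, h⟩ := h
  obtain ⟨a, ha, -⟩ := hD.et3_op _ _ _ _ _ _ (biprod.fst ≫ f) 0 (hD.realizes_zero W Z) h
    (by rw [Category.assoc, hf, comp_zero, comp_zero])
  exact ⟨a, by simpa using ha.symm⟩

theorem push_eq_zero_iff (hD : D.IsExtriangulated) {W : C} {δ : D.Ext Z A}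
    (h : D.Realizes δ x y) (f : A ⟶ W) : push f δ = 0 ↔ ∃ t : B ⟶ W, x ≫ t = f := by
  constructor
  · intro hf
    obtain ⟨b, hb, -⟩ := hD.realizes_hom _ _ _ _ _ _ f (𝟙 Z) h (hD.realizes_zero W Z)
      (by rw [hf, pull_zero])
    exact ⟨b ≫ biprod.fst, by rw [reassoc_of% hb]; simp⟩
  · rintro ⟨t, rfl⟩
    obtain ⟨c, -, hc⟩ := hD.et3 _ _ _ _ _ _ (x ≫ t) (t ≫ biprod.inl) h (hD.realizes_zero W Z)
      (by simp)
    rw [hc, pull_zero]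

theorem isIso_of_comp_eq_of_push_eq (hD : D.IsExtriangulated) {δ : D.Ext Z A}
    (h : D.Realizes δ x y) (a : A ⟶ A) (hx : a ≫ x = x) (ha : push a δ = δ) : IsIso a := by
  obtain ⟨t, ht⟩ := (hD.push_eq_zero_iff h (a - 𝟙 A)).1
    (by rw [hD.push_sub, ha, push_id, sub_self])
  refine isIso_of_sub_id_comp_self_eq_zero a ?_
  calc (a - 𝟙 A) ≫ (a - 𝟙 A) = ((a - 𝟙 A) ≫ x) ≫ t := by rw [Category.assoc, ht]
    _ = 0 := by rw [Preadditive.sub_comp, hx, Category.id_comp, sub_self, zero_comp]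

theorem isIso_of_comp_eq_of_comp_eq (hD : D.IsExtriangulated) (h : D.Conflation x y) (b : B ⟶ B)
    (hx : x ≫ b = x) (hy : b ≫ y = y) : IsIso b := by
  obtain ⟨t, ht⟩ := hD.exists_lift h (b - 𝟙 B)
    (by rw [Preadditive.sub_comp, hy, Category.id_comp, sub_self])
  refine isIso_of_sub_id_comp_self_eq_zero b ?_
  calc (b - 𝟙 B) ≫ (b - 𝟙 B) = t ≫ (x ≫ (b - 𝟙 B)) := by rw [← Category.assoc, ht]
    _ = 0 := by rw [Preadditive.comp_sub, hx, Category.comp_id, sub_self, comp_zero]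

theorem conflation_comp_iso (hD : D.IsExtriangulated) {Z' : C} (h : D.Conflation x y)
    (e : Z ≅ Z') : D.Conflation x (y ≫ e.hom) := by
  obtain ⟨δ, h⟩ := h
  obtain ⟨B', x', y', h'⟩ := hD.exists_realizes (pull e.inv δ)
  obtain ⟨b, hxb, hby⟩ := hD.realizes_hom _ _ _ _ _ _ (𝟙 A) e.hom h h'
    (by rw [push_id, ← pull_comp, e.hom_inv_id, pull_id])
  obtain ⟨b', hxb', hby'⟩ := hD.realizes_hom _ _ _ _ _ _ (𝟙 A) e.inv h' h (push_id _)
  rw [Category.id_comp] at hxb hxb'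
  have : IsIso (b ≫ b') := hD.isIso_of_comp_eq_of_comp_eq ⟨δ, h⟩ _ (by rw [reassoc_of% hxb, hxb'])
    (by rw [Category.assoc, hby', reassoc_of% hby, e.hom_inv_id, Category.comp_id])
  have : IsIso (b' ≫ b) := hD.isIso_of_comp_eq_of_comp_eq ⟨_, h'⟩ _ (by rw [reassoc_of% hxb', hxb])
    (by rw [Category.assoc, hby, reassoc_of% hby', e.inv_hom_id, Category.comp_id])
  have : IsIso b' := isIso_of_isIso_comp_comp b' b
  have hr := hD.realizes_of_iso _ _ _ (asIso b') h'
  have hy : inv b' ≫ y' = y ≫ e.hom := by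
    rw [IsIso.inv_comp_eq, reassoc_of% hby', e.inv_hom_id, Category.comp_id]
  rw [asIso_hom, asIso_inv, hxb', hy] at hr
  exact ⟨_, hr⟩

theorem nonempty_retract_fibre (hD : D.IsExtriangulated) {A' B' Z' : C} {x' : A' ⟶ B'}
    {y' : B' ⟶ Z'} (h : D.Conflation x y) (h' : D.Conflation x' y') (ρ : RetractArrow y y') :
    Nonempty (Retract A A') := by
  obtain ⟨δ, h⟩ := h
  obtain ⟨δ', h'⟩ := h'
  obtain ⟨i, hi, hδ⟩ := hD.et3_op _ _ _ _ _ _ ρ.i.left ρ.i.right h h' ρ.i_w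
  obtain ⟨r, hr, hδ'⟩ := hD.et3_op _ _ _ _ _ _ ρ.r.left ρ.r.right h' h ρ.r_w
  have : IsIso (i ≫ r) := hD.isIso_of_comp_eq_of_push_eq h _
    (by rw [Category.assoc, ← hr, ← reassoc_of% hi, ρ.retract_left]; exact Category.comp_id x)
    (by rw [push_comp, hδ, push_pull, hδ', ← pull_comp, ρ.retract_right]; exact pull_id δ)
  exact ⟨i, r ≫ inv (i ≫ r), by rw [← Category.assoc, IsIso.hom_inv_id]⟩

theorem nonempty_iso_fibre (hD : D.IsExtriangulated) {A' : C} {x' : A' ⟶ B}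
    (h : D.Conflation x y) (h' : D.Conflation x' y) : Nonempty (A ≅ A') := by
  obtain ⟨δ, h⟩ := h
  obtain ⟨δ', h'⟩ := h'
  obtain ⟨a, ha, hδ⟩ := hD.et3_op _ _ _ _ _ _ (𝟙 B) (𝟙 Z) h h' (by simp)
  obtain ⟨b, hb, hδ'⟩ := hD.et3_op _ _ _ _ _ _ (𝟙 B) (𝟙 Z) h' h (by simp)
  rw [Category.comp_id] at ha hb
  rw [pull_id] at hδ hδ'
  have : IsIso (a ≫ b) := hD.isIso_of_comp_eq_of_push_eq h _ (by rw [Category.assoc, ← hb, ← ha])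
    (by rw [push_comp, hδ, hδ'])
  have : IsIso (b ≫ a) := hD.isIso_of_comp_eq_of_push_eq h' _ (by rw [Category.assoc, ← ha, ← hb])
    (by rw [push_comp, hδ', hδ])
  have : IsIso a := isIso_of_isIso_comp_comp a b
  exact ⟨asIso a⟩

theorem nonempty_iso_of_isZero_cone (hD : D.IsExtriangulated) (h : D.Conflation x y)
    (hZ : IsZero Z) : Nonempty (A ≅ B) := by
  obtain ⟨δ, h⟩ := h
  rw [hD.ext_eq_zero_of_isZero hZ δ] at h
  obtain ⟨b, -⟩ := hD.iso_of_realizes _ _ _ _ _ (hD.realizes_zero A Z) h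
  exact ⟨isoBiprodZero hZ ≪≫ b⟩

theorem exists_section_of_retraction (hD : D.IsExtriangulated) (h : D.Conflation x y) {r : B ⟶ A}
    (hr : x ≫ r = 𝟙 A) : ∃ s : Z ⟶ B, s ≫ y = 𝟙 Z ∧ D.Conflation s r := by
  have hxy := hD.comp_eq_zero h
  obtain ⟨s, hs⟩ := hD.exists_desc h (𝟙 B - r ≫ x)
    (by rw [Preadditive.comp_sub, reassoc_of% hr, Category.comp_id, sub_self])
  obtain ⟨t, ht⟩ : ∃ t : Z ⟶ B, t ≫ y = 𝟙 Z := by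
    obtain ⟨δ, h⟩ := h
    have hδ : δ = 0 := by rw [← push_id δ, hD.push_eq_zero_iff h]; exact ⟨r, hr⟩
    rw [hδ] at h
    obtain ⟨b, -, hb⟩ := hD.iso_of_realizes _ _ _ _ _ (hD.realizes_zero A Z) h
    exact ⟨biprod.inr ≫ b.hom, by rw [Category.assoc, hb, biprod.inr_snd]⟩
  have hts : t ≫ (𝟙 B - r ≫ x) = s := by rw [← hs, reassoc_of% ht]
  have hsy : s ≫ y = 𝟙 Z := by
    simp [← hts, Preadditive.sub_comp, hxy, ht]
  have hsr : s ≫ r = 0 := by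
    simp [← hts, Preadditive.sub_comp, hr]
  let e : Z ⊞ A ≅ B :=
    { hom := biprod.desc s x
      inv := biprod.lift y r
      hom_inv_id := by ext <;> simp [hsy, hsr, hxy, hr]
      inv_hom_id := by rw [biprod.lift_desc, hs, sub_add_cancel] }
  exact ⟨s, hsy, 0, by simpa [e] using hD.realizes_of_iso _ _ _ e (hD.realizes_zero Z A)⟩

/- (ET4) turns `A' ⟶ A ⟶ S` and `A ⟶ B ⟶ Z` into conflations `A' ⟶ B ⟶ N` and `S ⟶ N ⟶ Z`.
The latter splits since `x ≫ f` extends to `B`, and a retraction `r : N ⟶ S` can be chosen with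
`B ⟶ N ⟶ S` equal to `f`; (ET4)ᵒᵖ applied to `A' ⟶ B ⟶ N` and `Z ⟶ N ⟶ S` gives the fibre. -/
theorem exists_fibre_of_comp (hD : D.IsExtriangulated) {A' S : C} {i : A' ⟶ A} {f : B ⟶ S}
    (hi : D.Conflation i (x ≫ f)) (h : D.Conflation x y) :
    ∃ (Y : C) (k : Y ⟶ B) (d : A' ⟶ Y), D.Conflation k f ∧ D.Conflation d (k ≫ y) := by
  obtain ⟨δ, hδ⟩ := hi
  obtain ⟨δ', hδ'⟩ := h
  obtain ⟨N, p, d, e, δ'', hp, hd, he, hde, -, -⟩ := hD.et4 _ _ _ _ _ _ hδ hδ'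
  obtain ⟨r, hdr, hpr⟩ : ∃ r : N ⟶ S, d ≫ r = 𝟙 S ∧ p ≫ r = f := by
    obtain ⟨r, hdr⟩ := (hD.push_eq_zero_iff hde (𝟙 S)).1
      (by rw [push_id, hD.push_eq_zero_iff hδ']; exact ⟨f, rfl⟩)
    obtain ⟨c, hc⟩ := hD.exists_desc ⟨δ', hδ'⟩ (f - p ≫ r)
      (by simp [Preadditive.comp_sub, ← reassoc_of% hd, hdr])
    refine ⟨r + e ≫ c, ?_, ?_⟩
    · rw [Preadditive.comp_add, hdr, reassoc_of% hD.comp_eq_zero ⟨_, hde⟩, zero_comp, add_zero]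
    · rw [Preadditive.comp_add, reassoc_of% he, hc, add_sub_cancel]
  obtain ⟨s, hse, σ, hs⟩ := hD.exists_section_of_retraction ⟨_, hde⟩ hdr
  obtain ⟨Y, k, d', e', ε, hk, -, hke, hY, -, -⟩ := hD.et4_op _ _ _ _ _ _ hp hs
  rw [hpr] at hk
  have hky : k ≫ y = e' := by rw [← he, reassoc_of% hke, hse, Category.comp_id]
  exact ⟨Y, k, d', ⟨_, hk⟩, hky ▸ ⟨_, hY⟩⟩

end Conflations

end IsExtriangulated

section Length

variable {C : Type u} [Category.{v} C] {D : ExtData.{w} C} {𝒳 : ObjectProperty C}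

theorem HasFiltration.length_le {M : C} {l : List C} (h : D.HasFiltration 𝒳 M l) :
    D.length 𝒳 M ≤ l.length :=
  Nat.sInf_le ⟨l, h, rfl⟩

theorem Filt.exists_length_eq {M : C} (hM : D.Filt 𝒳 M) :
    ∃ l, D.HasFiltration 𝒳 M l ∧ l.length = D.length 𝒳 M :=
  let ⟨l, hl⟩ := hM
  Nat.sInf_mem (s := {n | ∃ l, D.HasFiltration 𝒳 M l ∧ l.length = n}) ⟨_, l, hl, rfl⟩

theorem length_le_length_add_one {M N X : C} {f : M ⟶ N} {g : N ⟶ X} (h : D.Conflation f g)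
    (hX : 𝒳 X) (hM : D.Filt 𝒳 M) : D.length 𝒳 N ≤ D.length 𝒳 M + 1 := by
  obtain ⟨l, hl, hlen⟩ := hM.exists_length_eq
  simpa [hlen] using (HasFiltration.step f g h hX hl).length_le

end Length

namespace IsExtriangulated

variable {C : Type u} [Category.{v} C] [Preadditive C] [HasFiniteBiproducts C] {D : ExtData.{w} C}
  {𝒳 : ObjectProperty C}

theorem hasFiltration_of_iso (hD : D.IsExtriangulated) {M N : C} {l : List C} (e : M ≅ N)
    (h : D.HasFiltration 𝒳 M l) : D.HasFiltration 𝒳 N l := by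
  cases h with
  | zero hM => exact .zero (hM.of_iso e.symm)
  | step f g h hX hM =>
    obtain ⟨δ, hδ⟩ := h
    exact .step _ _ ⟨δ, hD.realizes_of_iso _ _ _ e hδ⟩ hX hM

theorem hasFiltration_singleton (hD : D.IsExtriangulated) {X : C} (hX : 𝒳 X) :
    D.HasFiltration 𝒳 X [X] := by
  obtain ⟨O, hO⟩ := HasZeroObject.zero (C := C)
  exact .step (l := []) _ _
    ⟨0, hD.realizes_of_iso _ _ _ (isoZeroBiprod hO).symm (hD.realizes_zero O X)⟩ hX (.zero hO)

theorem hasFiltration_of_conflation (hD : D.IsExtriangulated) {A B Z : C} {x : A ⟶ B}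
    {y : B ⟶ Z} {l l' : List C} (h : D.Conflation x y) (hA : D.HasFiltration 𝒳 A l)
    (hZ : D.HasFiltration 𝒳 Z l') : D.HasFiltration 𝒳 B (l ++ l') := by
  induction hZ generalizing B with
  | zero hZ =>
    obtain ⟨e⟩ := hD.nonempty_iso_of_isZero_cone h hZ
    simpa only [List.append_nil] using hD.hasFiltration_of_iso e hA
  | step f g hfg hX _ ih =>
    obtain ⟨δ, h⟩ := h
    obtain ⟨δ', hfg⟩ := hfg
    obtain ⟨N, k, d, e, δ'', hk, -, -, hd, -, -⟩ := hD.et4_op _ _ _ _ _ _ h hfg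
    rw [← List.append_assoc]
    exact .step _ _ ⟨_, hk⟩ hX (ih ⟨_, hd⟩)

theorem isExtensionClosed_filt (hD : D.IsExtriangulated) : D.IsExtensionClosed (D.Filt 𝒳) :=
  fun _ _ _ _ _ h ⟨_, hA⟩ ⟨_, hZ⟩ => ⟨_, hD.hasFiltration_of_conflation h hA hZ⟩

theorem le_filt (hD : D.IsExtriangulated) : 𝒳 ≤ D.Filt 𝒳 :=
  fun _ hX => ⟨_, hD.hasFiltration_singleton hX⟩

theorem hom_eq_zero_of_filt (hD : D.IsExtriangulated) {M N : C} (hN : D.Filt 𝒳 N)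
    (h : ∀ S, 𝒳 S → ∀ f : M ⟶ S, f = 0) (f : M ⟶ N) : f = 0 := by
  obtain ⟨l, hl⟩ := hN
  induction hl with
  | zero hN => exact hN.eq_of_tgt _ _
  | step x y hxy hX _ ih =>
    obtain ⟨a, ha⟩ := hD.exists_lift hxy f (h _ hX _)
    rw [← ha, ih a, zero_comp]

theorem exists_fibre_of_ne_zero (hD : D.IsExtriangulated) (h𝒳 : IsSemibrick 𝒳) {M S : C}
    {l : List C} (hM : D.HasFiltration 𝒳 M l) (hS : 𝒳 S) (f : M ⟶ S) (hf : f ≠ 0) :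
    ∃ (Y : C) (k : Y ⟶ M) (l' : List C), D.Conflation k f ∧ D.HasFiltration 𝒳 Y l' ∧
      isoClasses l = isoClasses (l' ++ [S]) := by
  induction hM with
  | zero hM => exact absurd (hM.eq_of_src _ _) hf
  | @step A M Z l x y h hZ hA ih =>
    by_cases hxf : x ≫ f = 0
    · obtain ⟨c, rfl⟩ := hD.exists_desc h f hxf
      have : IsIso c := h𝒳.isIso_of_ne_zero hZ hS fun hc => hf (by rw [hc, comp_zero])
      exact ⟨A, x, l, hD.conflation_comp_iso h (asIso c), hA, by
        rw [isoClasses_append, isoClasses_append, isoClasses_singleton_eq (asIso c)]⟩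
    · obtain ⟨Y, k, l', hk, hY, hl⟩ := ih (x ≫ f) hxf
      obtain ⟨Y', k', d, hk', hd⟩ := hD.exists_fibre_of_comp hk h
      refine ⟨Y', k', l' ++ [Z], hk', .step _ _ hd hZ hY, ?_⟩
      simp only [isoClasses_append, hl, add_right_comm]

/- A nonzero `f : M ⟶ S` with `S` in `𝒳` has a fibre that is a retract of the fibre of
`N ⟶ M ⟶ S`, and the latter has a filtration with one factor less than `l`. -/
theorem length_le_of_retract (hD : D.IsExtriangulated) (h𝒳 : IsSemibrick 𝒳) {M N : C}
    {l : List C} (ρ : Retract M N) (hM : D.Filt 𝒳 M) (hN : D.HasFiltration 𝒳 N l) :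
    D.length 𝒳 M ≤ l.length := by
  by_cases hzero : ∀ S, 𝒳 S → ∀ f : M ⟶ S, f = 0
  · have : IsZero M := (IsZero.iff_id_eq_zero M).2 (hD.hom_eq_zero_of_filt hM hzero _)
    exact (HasFiltration.zero this).length_le.trans (Nat.zero_le _)
  · push Not at hzero
    obtain ⟨S, hS, f, hf⟩ := hzero
    have hrf : ρ.r ≫ f ≠ 0 := fun h => hf (by
      rw [← Category.id_comp f, ← ρ.retract, Category.assoc, h, comp_zero])
    obtain ⟨lM, hlM⟩ := hM
    obtain ⟨Y, k, lY, hk, hY, -⟩ := hD.exists_fibre_of_ne_zero h𝒳 hlM hS f hf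
    obtain ⟨Y', k', l', hk', hY', hl⟩ := hD.exists_fibre_of_ne_zero h𝒳 hN hS (ρ.r ≫ f) hrf
    have hlen : l.length = l'.length + 1 := by simpa using length_eq_of_isoClasses_eq hl
    obtain ⟨ρ'⟩ := hD.nonempty_retract_fibre hk hk'
      { i := Arrow.homMk ρ.i (𝟙 S), r := Arrow.homMk ρ.r (𝟙 S) }
    calc D.length 𝒳 M ≤ D.length 𝒳 Y + 1 := length_le_length_add_one hk hS ⟨lY, hY⟩
      _ ≤ l'.length + 1 := by gcongr; exact hD.length_le_of_retract h𝒳 ρ' ⟨lY, hY⟩ hY'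
      _ = l.length := hlen.symm
termination_by l.length

theorem isoClasses_eq_of_length_eq (hD : D.IsExtriangulated) (h𝒳 : IsSemibrick 𝒳) {M : C}
    {l l' : List C} (hl : D.HasFiltration 𝒳 M l) (hl' : D.HasFiltration 𝒳 M l')
    (hlen : l.length = D.length 𝒳 M) (hlen' : l'.length = D.length 𝒳 M) :
    isoClasses l = isoClasses l' := by
  induction hl' generalizing l with
  | zero => rw [List.eq_nil_of_length_eq_zero (hlen.trans hlen'.symm)]
  | @step N M S l₀ x y hxy hS hN ih =>
    rw [List.length_append, List.length_singleton] at hlen'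
    have hy : y ≠ 0 := by
      rintro rfl
      obtain ⟨s, hs⟩ := hD.exists_lift hxy (𝟙 M) comp_zero
      have := hD.length_le_of_retract h𝒳 ⟨s, x, hs⟩ ⟨l, hl⟩ hN
      lia
    obtain ⟨Y, k, l₁, hk, hY, hl₁⟩ := hD.exists_fibre_of_ne_zero h𝒳 hl hS y hy
    obtain ⟨e⟩ := hD.nonempty_iso_fibre hk hxy
    have hlen₁ : l.length = l₁.length + 1 := by simpa using length_eq_of_isoClasses_eq hl₁
    have hN_length : D.length 𝒳 N = l₀.length := by
      have := hN.length_le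
      have := length_le_length_add_one hxy hS ⟨l₀, hN⟩
      lia
    have hfactors : isoClasses l₁ = isoClasses l₀ :=
      ih (hD.hasFiltration_of_iso e hY) (by lia) hN_length.symm
    rw [hl₁, isoClasses_append, isoClasses_append, hfactors]

end IsExtriangulated

section Restriction

variable {C : Type u} [Category.{v} C] {D : ExtData.{w} C} {𝒳 T : ObjectProperty C}

theorem HasFiltration.of_restrict [Preadditive C] {M : T.FullSubcategory}
    {l : List T.FullSubcategory} (h : (D.restrict T).HasFiltration (𝒳.inverseImage T.ι) M l) :
    D.HasFiltration 𝒳 M.obj (l.map T.ι.obj) := by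
  induction h with
  | zero hM => exact .zero (T.ι.map_isZero hM)
  | step f g h hX _ ih =>
    rw [List.map_append]
    exact .step _ _ h hX ih

theorem HasFiltration.exists_restrict (h𝒳T : 𝒳 ≤ T) (hT : D.Filt 𝒳 ≤ T) {M : C} {l : List C}
    (h : D.HasFiltration 𝒳 M l) (hM : T M) :
    ∃ l' : List T.FullSubcategory,
      (D.restrict T).HasFiltration (𝒳.inverseImage T.ι) ⟨M, hM⟩ l' ∧ l'.map T.ι.obj = l := by
  induction h with
  | zero h => exact ⟨[], .zero (IsZero.of_full_of_faithful_of_isZero T.ι _ h), rfl⟩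
  | @step M N X l f g h hX hl ih =>
    obtain ⟨l', hl', rfl⟩ := ih (hT _ ⟨_, hl⟩)
    exact ⟨l' ++ [⟨X, h𝒳T _ hX⟩], .step (X := ⟨X, h𝒳T _ hX⟩) (ObjectProperty.homMk f)
      (ObjectProperty.homMk g) h hX hl', List.map_append⟩

theorem length_restrict [Preadditive C] (h𝒳T : 𝒳 ≤ T) (hT : D.Filt 𝒳 ≤ T)
    (M : T.FullSubcategory) :
    (D.restrict T).length (𝒳.inverseImage T.ι) M = D.length 𝒳 M.obj := by
  refine congrArg sInf (Set.ext fun n => ⟨?_, ?_⟩)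
  · rintro ⟨l, hl, rfl⟩
    exact ⟨_, hl.of_restrict, List.length_map _⟩
  · rintro ⟨l, hl, rfl⟩
    obtain ⟨l', hl', rfl⟩ := hl.exists_restrict h𝒳T hT M.property
    exact ⟨l', hl', (List.length_map _).symm⟩

theorem IsExtriangulated.weakJordanHolder_filt [Preadditive C] [HasFiniteBiproducts C]
    (hD : D.IsExtriangulated) (h𝒳 : IsSemibrick 𝒳) :
    (D.restrict (D.Filt 𝒳)).WeakJordanHolder (𝒳.inverseImage (D.Filt 𝒳).ι) where
  filt := fun ⟨_, l, hl⟩ =>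
    let ⟨l', hl', _⟩ := hl.exists_restrict hD.le_filt le_rfl ⟨l, hl⟩
    ⟨l', hl'⟩
  unique M l l' hl hl' hlen hlen' := by
    rw [length_restrict hD.le_filt le_rfl] at hlen hlen'
    refine .of_map_obj (D.Filt 𝒳).ι (.of_isoClasses_eq ?_)
    exact hD.isoClasses_eq_of_length_eq h𝒳 hl.of_restrict hl'.of_restrict
      ((List.length_map _).trans hlen) ((List.length_map _).trans hlen')

end Restriction

end ExtData

end Extri

theorem theorem3p4_general {C : Type u} [Category.{v} C] [Preadditive C] [HasFiniteBiproducts C]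
    (D : Extri.ExtData.{w} C) (hD : D.IsExtriangulated)
    (𝒳 : ObjectProperty C) (h𝒳 : Extri.IsSemibrick 𝒳) :
    𝒳 ≤ D.Filt 𝒳 ∧ D.IsExtensionClosed (D.Filt 𝒳) ∧
      (D.restrict (D.Filt 𝒳)).WeakJordanHolder (𝒳.inverseImage (D.Filt 𝒳).ι) :=
  ⟨hD.le_filt, hD.isExtensionClosed_filt, hD.weakJordanHolder_filt h𝒳⟩

theorem theorem3p4 {C : Type u} [Category.{v} C] [Preadditive C] [HasFiniteBiproducts C]
    [EssentiallySmall.{v} C] (hKS : Extri.IsKrullSchmidt C)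
    (D : Extri.ExtData.{w} C) (hD : D.IsExtriangulated)
    (𝒳 : ObjectProperty C) (h𝒳 : Extri.IsSemibrick 𝒳) :
    𝒳 ≤ D.Filt 𝒳 ∧ D.IsExtensionClosed (D.Filt 𝒳) ∧
      (D.restrict (D.Filt 𝒳)).WeakJordanHolder (𝒳.inverseImage (D.Filt 𝒳).ι) :=
  theorem3p4_general D hD 𝒳 h𝒳
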